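/- Let $m_2<m_1$ be nonnegative integers, let $n=m_1+m_2+1$, and let $a,b>0$. For a function $f$ on $(0,\infty)$ with sufficiently many derivatives and $a\neq b$, let $P$ and $Q$ be the Hermite interpolants of $f$, that is, the polynomials of degree at most $n$ with $$P^{(j)}(a)=f^{(j)}(a)\ (0\le j\le m_1),\qquad P^{(j)}(b)=f^{(j)}(b)\ (0\le j\le m_2),$$ $$Q^{(j)}(a)=f^{(j)}(a)\ (0\le j\le m_2),\qquad Q^{(j)}(b)=f^{(j)}(b)\ (0\le j\le m_1).$$ Let $M_{f,m_1,m_2}(a,b)$ be the unique $x_0$ strictly between $a$ and $b$ such that $P(x_0)=Q(x_0)$ if $m_1-m_2$ is even, respectively $f(x_0)=\tfrac12\left(P(x_0)+Q(x_0)\right)$ if $m_1-m_2$ is odd; and put $M_{f,m_1,m_2}(a,a)=a$. For real $p$ let $M_{p,m_1,m_2}=M_{f,m_1,m_2}$ with $f(x)=x^p$ if $p\notin\{0,1,\dots,n\}$, and with $f(x)=x^p\log x$ if $p\in\{0,1,\dots,n\}$. Then $$\lim_{p\to\infty}M_{p,m_1,m_2}(a,b)=\max\{a,b\}\qquad\text{and}\qquad\lim_{p\to-\infty}M_{p,m_1,m_2}(a,b)=\min\{a,b\}.$$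 -/

import Mathlib

open Filter Topology

noncomputable section

/-- `R` is the Hermite interpolant to `f` which matches `f` to order `k` at `a` and to order `l`
at `b`: a polynomial of degree at most `k + l + 1` whose derivatives of orders `0, …, k` agree with
those of `f` at `a`, and whose derivatives of orders `0, …, l` agree with those of `f` at `b`. -/
def IsHermiteInterpolant (f : ℝ → ℝ) (a : ℝ) (k : ℕ) (b : ℝ) (l : ℕ) (R : Polynomial ℝ) : Prop :=
  R.natDegree ≤ k + l + 1 ∧
  (∀ j ≤ k, (Polynomial.derivative^[j] R).eval a = iteratedDeriv j f a) ∧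
  (∀ j ≤ l, (Polynomial.derivative^[j] R).eval b = iteratedDeriv j f b)

/-- `x` lies strictly between `a` and `b` and, for the two Hermite interpolants `P` (order `m₁` at
`a`, order `m₂` at `b`) and `Q` (order `m₂` at `a`, order `m₁` at `b`) to `f`, it satisfies
`P x = Q x` if `m₁ - m₂` is even, and `f x = (P x + Q x) / 2` if `m₁ - m₂` is odd. -/
def IsHermiteMeanPoint (f : ℝ → ℝ) (m₁ m₂ : ℕ) (a b x : ℝ) : Prop :=
  x ∈ Set.Ioo (min a b) (max a b) ∧
  ∃ P Q : Polynomial ℝ,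
    IsHermiteInterpolant f a m₁ b m₂ P ∧ IsHermiteInterpolant f a m₂ b m₁ Q ∧
    (Even (m₁ - m₂) → P.eval x = Q.eval x) ∧
    (Odd (m₁ - m₂) → f x = (P.eval x + Q.eval x) / 2)

open Classical in
/-- The mean `M_{f,m₁,m₂}(a,b)`: the unique point of the preceding definition if `a ≠ b`, and `a`
on the diagonal. (Where there is no unique such point the value is `0`, which is not between `a`
and `b` for positive `a` and `b`.) -/
def hermiteMean (f : ℝ → ℝ) (m₁ m₂ : ℕ) (a b : ℝ) : ℝ :=
  if a = b then a
  else if h : ∃! x, IsHermiteMeanPoint f m₁ m₂ a b x then h.choose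
  else 0

open Classical in
/-- The function `x ↦ x ^ p`, replaced by `x ↦ x ^ p * log x` if `p ∈ {0, 1, …, n}`. -/
def powerFun (n : ℕ) (p : ℝ) : ℝ → ℝ :=
  if ∃ k : ℕ, k ≤ n ∧ p = k then fun x => x ^ p * Real.log x else fun x => x ^ p

/-- The mean `M_{p,m₁,m₂}(a,b)`, for every real number `p`. -/
def powerHermiteMean (p : ℝ) (m₁ m₂ : ℕ) (a b : ℝ) : ℝ :=
  hermiteMean (powerFun (m₁ + m₂ + 1) p) m₁ m₂ a b

end

/-! ### Dividing an analytic function by a linear factor -/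

/-! By symmetry let a < b, and let σ be a sign with σ f^(n+1) > 0. Both parities of the mean
condition say that (f - P) - (-1)^(m₁-m₂) (f - Q) vanishes. Each error has zeros of order at least
m₂ + 1 at both nodes. Divided by (x-a)^(m₂+1) (x-b)^(m₂+1) and multiplied by σ, this combination
becomes a strictly increasing E with E a < 0 < E b (`exists_strictMonoOn_eq_nodal_mul`). So the mean
exists, is unique, and lies to the right of y exactly when E y < 0;
`hermiteMean_mem_Ioo_and_position` records this through the sign of the undivided combination.

It remains to find the sign of E at a fixed y for extreme p. As p → ∞, divide by f^(m₁)(b): the data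
at a are O((a/b)^p), and lower derivatives at b are smaller by powers of 1/p. Hence f(y) and P(y)
become negligible, while Q tends to the polynomial whose only nonzero datum is its m₁-th derivative
at b, a positive multiple of (y-b)^m₁ (y-a)^(m₂+1) (`tendsto_rpow_interpolants_div`). This forces E
y < 0, so the mean eventually passes every y < b. As p → -∞ the node a dominates and P, Q exchange
roles. -/

theorem AnalyticOnNhd.dslope_real {S : Set ℝ} {F : ℝ → ℝ} (hF : AnalyticOnNhd ℝ F S) (c : ℝ) :
    AnalyticOnNhd ℝ (dslope F c) S := by
  intro x hx
  rcases eq_or_ne x c with rfl | hne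
  · obtain ⟨p, hp⟩ := hF x hx
    exact ⟨_, hp.has_fpower_series_dslope_fslope⟩
  · refine AnalyticAt.congr ?_ (dslope_eventuallyEq_slope_of_ne F hne).symm
    have h : AnalyticAt ℝ (fun y => (y - c)⁻¹ * (F y - F c)) x :=
      ((analyticAt_id.sub analyticAt_const).inv (by simpa [sub_eq_zero] using hne)).mul
        ((hF x hx).sub analyticAt_const)
    exact h.congr (Eventually.of_forall fun y => by simp [slope])

theorem AnalyticAt.hasDerivAt_iteratedDeriv {g : ℝ → ℝ} {x : ℝ} (hg : AnalyticAt ℝ g x) (k : ℕ) :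
    HasDerivAt (iteratedDeriv k g) (iteratedDeriv (k + 1) g x) x := by
  have h : AnalyticAt ℝ (iteratedDeriv k g) x := by
    rw [iteratedDeriv_eq_iterate]; exact hg.iterated_deriv k
  rw [iteratedDeriv_succ]
  exact h.differentiableAt.hasDerivAt

theorem iteratedDeriv_succ_sub_mul {S : Set ℝ} (hS : IsOpen S) {g : ℝ → ℝ}
    (hg : AnalyticOnNhd ℝ g S) (c : ℝ) (k : ℕ) {x : ℝ} (hx : x ∈ S) :
    iteratedDeriv (k + 1) (fun t => (t - c) * g t) x =
      (x - c) * iteratedDeriv (k + 1) g x + (k + 1) * iteratedDeriv k g x := by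
  induction k generalizing x with
  | zero =>
    have h := ((hasDerivAt_id x).sub_const c).mul ((hg x hx).hasDerivAt_iteratedDeriv 0)
    simp only [iteratedDeriv_zero, id] at h
    have h' : HasDerivAt (fun t => (t - c) * g t)
      (1 * g x + (x - c) * iteratedDeriv (0 + 1) g x) x := h
    rw [iteratedDeriv_succ, iteratedDeriv_zero, h'.deriv, iteratedDeriv_zero]
    push_cast; ring
  | succ k ih =>
    have h := (((hasDerivAt_id x).sub_const c).mul ((hg x hx).hasDerivAt_iteratedDeriv (k + 1))).add
      (((hg x hx).hasDerivAt_iteratedDeriv k).const_mul ((k : ℝ) + 1))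
    have h' := h.congr_of_eventuallyEq (f₁ := iteratedDeriv (k + 1) (fun t => (t - c) * g t))
      (by filter_upwards [hS.mem_nhds hx] with y hy
          simpa using ih hy)
    rw [iteratedDeriv_succ, h'.deriv]
    simp only [id]
    push_cast; ring

theorem iteratedDeriv_eq_zero_of_sub_mul {S : Set ℝ} (hS : IsOpen S) {g : ℝ → ℝ}
    (hg : AnalyticOnNhd ℝ g S) {c : ℝ} (hc : c ∈ S) {k : ℕ}
    (h : ∀ j < k + 1, iteratedDeriv j (fun t => (t - c) * g t) c = 0) :
    ∀ j < k, iteratedDeriv j g c = 0 := by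
  intro j hj
  have := h (j + 1) (by omega)
  rw [iteratedDeriv_succ_sub_mul hS hg c j hc, sub_self, zero_mul, zero_add] at this
  exact (mul_eq_zero.1 this).resolve_left (by positivity)

theorem iteratedDeriv_eq_zero_of_sub_mul_of_ne {S : Set ℝ} (hS : IsOpen S) {g : ℝ → ℝ}
    (hg : AnalyticOnNhd ℝ g S) {c e : ℝ} (he : e ∈ S) (hne : e ≠ c) {k : ℕ}
    (h : ∀ j < k, iteratedDeriv j (fun t => (t - c) * g t) e = 0) :
    ∀ j < k, iteratedDeriv j g e = 0 := by
  intro j hj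
  induction j with
  | zero =>
    have := h 0 hj
    simp only [iteratedDeriv_zero] at this ⊢
    exact (mul_eq_zero.1 this).resolve_left (sub_ne_zero.2 hne)
  | succ j ih =>
    have := h (j + 1) hj
    rw [iteratedDeriv_succ_sub_mul hS hg c j he, ih (by omega), mul_zero, add_zero] at this
    exact (mul_eq_zero.1 this).resolve_left (sub_ne_zero.2 hne)

/-- The power k + 1 is the integrating factor that turns the Leibniz identity for (t - c) g into an
exact derivative. -/
theorem hasDerivAt_sub_pow_mul_iteratedDeriv {S : Set ℝ} (hS : IsOpen S) {g : ℝ → ℝ}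
    (hg : AnalyticOnNhd ℝ g S) (c : ℝ) (k : ℕ) {x : ℝ} (hx : x ∈ S) :
    HasDerivAt (fun t => (t - c) ^ (k + 1) * iteratedDeriv k g t)
      ((x - c) ^ k * iteratedDeriv (k + 1) (fun t => (t - c) * g t) x) x := by
  have h := (((hasDerivAt_id x).sub_const c).pow (k + 1)).mul
    ((hg x hx).hasDerivAt_iteratedDeriv k)
  refine HasDerivAt.congr_deriv h ?_
  rw [iteratedDeriv_succ_sub_mul hS hg c k hx]
  simp only [id, Nat.add_sub_cancel]
  simp
  ring

/-- Away from c, apply the mean value theorem to φ = (t - c)^(k+1) g^(k), which vanishes at c; at c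
itself the Leibniz identity reduces to (k + 1) g^(k)(c). -/
theorem iteratedDeriv_pos_of_sub_mul {S : Set ℝ} (hS : IsOpen S) (hS' : S.OrdConnected)
    {g : ℝ → ℝ} (hg : AnalyticOnNhd ℝ g S) {c : ℝ} (hc : c ∈ S) {k : ℕ}
    (h : ∀ x ∈ S, 0 < iteratedDeriv (k + 1) (fun t => (t - c) * g t) x) :
    ∀ x ∈ S, 0 < iteratedDeriv k g x := by
  intro x hx
  set φ : ℝ → ℝ := fun t => (t - c) ^ (k + 1) * iteratedDeriv k g t with hφ
  have hder : ∀ t ∈ S, HasDerivAt φ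
      ((t - c) ^ k * iteratedDeriv (k + 1) (fun t => (t - c) * g t) t) t := fun t ht =>
    hasDerivAt_sub_pow_mul_iteratedDeriv hS hg c k ht
  have hφc : φ c = 0 := by simp [hφ]
  -- The powers of ξ - c and x - c enter only through their ratio, which is positive because ξ lies
  -- between c and x; the parity of k is therefore irrelevant.
  have key : ∀ ξ ∈ S, ξ ≠ c → x ≠ c → 0 < (ξ - c) / (x - c) →
      (ξ - c) ^ k * iteratedDeriv (k + 1) (fun t => (t - c) * g t) ξ = φ x / (x - c) →
      0 < iteratedDeriv k g x := by
    intro ξ hξ hξc hxc hr heq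
    have hxc' : x - c ≠ 0 := sub_ne_zero.2 hxc
    have : iteratedDeriv k g x =
        ((ξ - c) / (x - c)) ^ k * iteratedDeriv (k + 1) (fun t => (t - c) * g t) ξ := by
      rw [div_pow, div_mul_eq_mul_div, heq, hφ]
      field_simp
      ring
    rw [this]
    exact mul_pos (pow_pos hr k) (h ξ hξ)
  rcases lt_trichotomy x c with hlt | rfl | hlt
  · obtain ⟨ξ, hξ, heq⟩ := exists_hasDerivAt_eq_slope φ _ hlt
      (fun t ht => (hder t (hS'.out hx hc ht)).continuousAt.continuousWithinAt)
      (fun t ht => hder t (hS'.out hx hc (Set.Ioo_subset_Icc_self ht)))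
    refine key ξ (hS'.out hx hc (Set.Ioo_subset_Icc_self hξ)) hξ.2.ne hlt.ne
      (div_pos_of_neg_of_neg (sub_neg.2 hξ.2) (sub_neg.2 hlt)) ?_
    rw [heq, hφc, zero_sub, ← neg_sub x c, neg_div_neg_eq]
  · have := h x hx
    rw [iteratedDeriv_succ_sub_mul hS hg x k hx, sub_self, zero_mul, zero_add] at this
    exact pos_of_mul_pos_right this (by positivity)
  · obtain ⟨ξ, hξ, heq⟩ := exists_hasDerivAt_eq_slope φ _ hlt
      (fun t ht => (hder t (hS'.out hc hx ht)).continuousAt.continuousWithinAt)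
      (fun t ht => hder t (hS'.out hc hx (Set.Ioo_subset_Icc_self ht)))
    refine key ξ (hS'.out hc hx (Set.Ioo_subset_Icc_self hξ)) hξ.1.ne' hlt.ne'
      (div_pos (sub_pos.2 hξ.1) (sub_pos.2 hlt)) ?_
    rw [heq, hφc, sub_zero]

/-- An analytic function vanishing to order `i + k` at `c` is `(x - c) ^ i` times an analytic
function that vanishes to order `k` at `c`; zeros at a second point and positivity of a higher
derivative are inherited by the quotient. -/
theorem exists_analytic_eq_sub_pow_mul {S : Set ℝ} (hS : IsOpen S) (hS' : S.OrdConnected)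
    {F : ℝ → ℝ} (hF : AnalyticOnNhd ℝ F S) {c e : ℝ} (hc : c ∈ S) (he : e ∈ S) (hne : e ≠ c)
    (i k l N : ℕ) (hFc : ∀ j < i + k, iteratedDeriv j F c = 0)
    (hFe : ∀ j < l, iteratedDeriv j F e = 0)
    (hpos : ∀ x ∈ S, 0 < iteratedDeriv (N + i) F x) :
    ∃ u : ℝ → ℝ, AnalyticOnNhd ℝ u S ∧ (∀ x, F x = (x - c) ^ i * u x) ∧
      (∀ j < k, iteratedDeriv j u c = 0) ∧ (∀ j < l, iteratedDeriv j u e = 0) ∧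
      ∀ x ∈ S, 0 < iteratedDeriv N u x := by
  induction i generalizing F with
  | zero => exact ⟨F, hF, by simp, by simpa using hFc, hFe, hpos⟩
  | succ i ih =>
    have hg := hF.dslope_real c
    have hFg : F = fun t => (t - c) * dslope F c t := by
      funext t
      have h0 : F c = 0 := by simpa using hFc 0 (by omega)
      simpa [h0] using (sub_smul_dslope F c t).symm
    have h1 : ∀ j < i + k, iteratedDeriv j (dslope F c) c = 0 := by
      apply iteratedDeriv_eq_zero_of_sub_mul hS hg hc
      rw [← hFg]; intro j hj; exact hFc j (by omega)
    have h2 : ∀ j < l, iteratedDeriv j (dslope F c) e = 0 := by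
      apply iteratedDeriv_eq_zero_of_sub_mul_of_ne hS hg he hne
      rwa [← hFg]
    have h3 : ∀ x ∈ S, 0 < iteratedDeriv (N + i) (dslope F c) x := by
      apply iteratedDeriv_pos_of_sub_mul hS hS' hg hc
      rwa [← hFg]
    obtain ⟨u, hu, hu', hrest⟩ := ih hg h1 h2 h3
    refine ⟨u, hu, fun x => ?_, hrest⟩
    rw [show F x = (x - c) * dslope F c x from congrFun hFg x, hu']
    ring

/-- The derivative u' vanishes to order D at c and has positive D-th derivative; dividing out all
these zeros leaves a positive factor, so u' has the sign of (x - c)^D. -/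
theorem exists_deriv_eq_sub_pow_mul {S : Set ℝ} (hS : IsOpen S) (hS' : S.OrdConnected)
    {u : ℝ → ℝ} (hu : AnalyticOnNhd ℝ u S) {c e : ℝ} (hc : c ∈ S) (he : e ∈ S) (hne : e ≠ c)
    (D : ℕ) (huc : ∀ j < D + 1, iteratedDeriv j u c = 0)
    (hpos : ∀ x ∈ S, 0 < iteratedDeriv (D + 1) u x) :
    ∃ v : ℝ → ℝ, (∀ x, deriv u x = (x - c) ^ D * v x) ∧ ∀ x ∈ S, 0 < v x := by
  obtain ⟨v, -, hv, -, -, hv'⟩ := exists_analytic_eq_sub_pow_mul hS hS' hu.deriv hc he hne D 0 0 0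
    (by intro j hj; rw [← iteratedDeriv_succ']; exact huc _ (by omega)) (by simp)
    (by intro x hx; rw [← iteratedDeriv_succ', zero_add]; exact hpos x hx)
  exact ⟨v, hv, by simpa using hv'⟩

/-- For analytic `F` and `G` vanishing at `a` and `b` to the orders that Hermite interpolation
prescribes, `F - (-1) ^ (D + 1) G` is the product of the nodal polynomial of the common zeros and
of a strictly increasing function that changes sign on `[a, b]`. -/
theorem exists_strictMonoOn_eq_nodal_mul {S : Set ℝ} (hS : IsOpen S) (hS' : S.OrdConnected)
    {F G : ℝ → ℝ} (hF : AnalyticOnNhd ℝ F S) (hG : AnalyticOnNhd ℝ G S) {a b : ℝ}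
    (ha : a ∈ S) (hb : b ∈ S) (hab : a < b) (m D : ℕ)
    (hFa : ∀ j < m + (D + 1), iteratedDeriv j F a = 0) (hFb : ∀ j < m, iteratedDeriv j F b = 0)
    (hGa : ∀ j < m, iteratedDeriv j G a = 0) (hGb : ∀ j < m + (D + 1), iteratedDeriv j G b = 0)
    (hFpos : ∀ x ∈ S, 0 < iteratedDeriv (D + 1 + m + m) F x)
    (hGpos : ∀ x ∈ S, 0 < iteratedDeriv (D + 1 + m + m) G x) :
    ∃ E : ℝ → ℝ, ContinuousOn E (Set.Icc a b) ∧ StrictMonoOn E (Set.Icc a b) ∧ E a < 0 ∧ 0 < E b ∧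
      ∀ x, F x - (-1) ^ (D + 1) * G x = (x - a) ^ m * (x - b) ^ m * E x := by
  have factor : ∀ {H : ℝ → ℝ} {c e : ℝ}, AnalyticOnNhd ℝ H S → c ∈ S → e ∈ S → e ≠ c →
      (∀ j < m + (D + 1), iteratedDeriv j H c = 0) → (∀ j < m, iteratedDeriv j H e = 0) →
      (∀ x ∈ S, 0 < iteratedDeriv (D + 1 + m + m) H x) →
      ∃ u v : ℝ → ℝ, AnalyticOnNhd ℝ u S ∧ (∀ x, H x = (x - c) ^ m * (x - e) ^ m * u x) ∧
        u c = 0 ∧ (∀ x, deriv u x = (x - c) ^ D * v x) ∧ ∀ x ∈ S, 0 < v x := by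
    intro H c e hH hc he hne hHc hHe hHpos
    -- Only m of the zeros at c are divided out; the remaining D + 1 survive the second division, at
    -- e, and determine the sign of u'.
    obtain ⟨u₁, hu₁, hHu₁, hu₁c, hu₁e, hu₁pos⟩ := exists_analytic_eq_sub_pow_mul hS hS' hH hc he hne
      m (D + 1) m (D + 1 + m) hHc hHe hHpos
    obtain ⟨u, hu, hu₁u, -, huc, hupos⟩ := exists_analytic_eq_sub_pow_mul hS hS' hu₁ he hc hne.symm
      m 0 (D + 1) (D + 1) hu₁e hu₁c hu₁pos
    obtain ⟨v, hv, hvpos⟩ := exists_deriv_eq_sub_pow_mul hS hS' hu hc he hne D huc hupos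
    refine ⟨u, v, hu, fun x => ?_, by simpa using huc 0 (by omega), hv, hvpos⟩
    rw [hHu₁, hu₁u]; ring
  obtain ⟨u, v, hu, hFu, hua, huv, hv⟩ := factor hF ha hb hab.ne' hFa hFb hFpos
  obtain ⟨w, z, hw, hGw, hwb, hwz, hz⟩ := factor hG hb ha hab.ne hGb hGa hGpos
  have hsub : Set.Icc a b ⊆ S := hS'.out ha hb
  have hwcont : ContinuousOn (fun x => (-1) ^ D * w x) (Set.Icc a b) :=
    continuousOn_const.mul (hw.continuousOn.mono hsub)
  have hucont : ContinuousOn u (Set.Icc a b) := hu.continuousOn.mono hsub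
  have humono : StrictMonoOn u (Set.Icc a b) := by
    refine strictMonoOn_of_deriv_pos (convex_Icc a b) hucont fun x hx => ?_
    rw [interior_Icc] at hx
    rw [huv]
    exact mul_pos (pow_pos (sub_pos.2 hx.1) D) (hv x (hsub (Set.Ioo_subset_Icc_self hx)))
  have hwmono : StrictMonoOn (fun x => (-1) ^ D * w x) (Set.Icc a b) := by
    refine strictMonoOn_of_deriv_pos (convex_Icc a b) hwcont fun x hx => ?_
    rw [interior_Icc] at hx
    rw [deriv_const_mul_field, hwz, ← mul_assoc, ← mul_pow, neg_one_mul, neg_sub]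
    exact mul_pos (pow_pos (sub_pos.2 hx.2) D) (hz x (hsub (Set.Ioo_subset_Icc_self hx)))
  have hal : a ∈ Set.Icc a b := Set.left_mem_Icc.2 hab.le
  have hbr : b ∈ Set.Icc a b := Set.right_mem_Icc.2 hab.le
  -- Both summands increase; u vanishes at a and w at b, so at each endpoint a single summand fixes
  -- the sign.
  refine ⟨fun x => u x + (-1) ^ D * w x, hucont.add hwcont, humono.add hwmono, ?_, ?_, fun x => ?_⟩
  · have := hwmono hal hbr hab
    simpa [hua, hwb] using this
  · have := humono hal hbr hab
    simpa [hua, hwb] using this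
  · rw [hFu, hGw, pow_succ]; ring

/-! ### Hermite interpolation of arbitrary data -/

/-- `R` has degree less than `k + l`, its derivatives of order less than `k` at `c` are given by
`α`, and its derivatives of order less than `l` at `e` are given by `β`. -/
def InterpolatesData (c : ℝ) (k : ℕ) (e : ℝ) (l : ℕ) (α β : ℕ → ℝ) (R : Polynomial ℝ) : Prop :=
  R.degree < ((k + l : ℕ) : WithBot ℕ) ∧
  (∀ j < k, (Polynomial.derivative^[j] R).eval c = α j) ∧
  (∀ j < l, (Polynomial.derivative^[j] R).eval e = β j)

theorem InterpolatesData.symm {c e : ℝ} {k l : ℕ} {α β : ℕ → ℝ} {R : Polynomial ℝ}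
    (h : InterpolatesData c k e l α β R) : InterpolatesData e l c k β α R :=
  ⟨by rw [add_comm]; exact h.1, h.2.2, h.2.1⟩

theorem InterpolatesData.sub {c e : ℝ} {k l : ℕ} {α β α' β' : ℕ → ℝ} {R R' : Polynomial ℝ}
    (h : InterpolatesData c k e l α β R) (h' : InterpolatesData c k e l α' β' R') :
    InterpolatesData c k e l (α - α') (β - β') (R - R') := by
  refine ⟨(Polynomial.degree_sub_le _ _).trans_lt (max_lt h.1 h'.1), fun j hj => ?_, fun j hj => ?_⟩
  · simp [h.2.1 j hj, h'.2.1 j hj]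
  · simp [h.2.2 j hj, h'.2.2 j hj]

theorem InterpolatesData.C_mul {c e : ℝ} {k l : ℕ} {α β : ℕ → ℝ} {R : Polynomial ℝ}
    (h : InterpolatesData c k e l α β R) (s : ℝ) :
    InterpolatesData c k e l (fun j => s * α j) (fun j => s * β j) (Polynomial.C s * R) := by
  refine ⟨?_, fun j hj => ?_, fun j hj => ?_⟩
  · rw [← Polynomial.smul_eq_C_mul]
    exact (Polynomial.degree_smul_le _ _).trans_lt h.1
  · simp [Polynomial.iterate_derivative_C_mul, h.2.1 j hj]
  · simp [Polynomial.iterate_derivative_C_mul, h.2.2 j hj]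

theorem Polynomial.X_sub_C_pow_dvd_of_eval_iterate_derivative {R : Polynomial ℝ} {c : ℝ} {k : ℕ}
    (h : ∀ j < k, (derivative^[j] R).eval c = 0) : (X - C c) ^ k ∣ R := by
  rcases eq_or_ne R 0 with rfl | hR
  · exact dvd_zero _
  rcases k with _ | k
  · simp
  · rw [← le_rootMultiplicity_iff hR]
    exact lt_rootMultiplicity_of_isRoot_iterate_derivative hR fun j hj => h j (by omega)

theorem Polynomial.eval_iterate_derivative_of_X_sub_C_pow_dvd {R : Polynomial ℝ} {c : ℝ} {k j : ℕ}
    (h : (X - C c) ^ k ∣ R) (hj : j < k) : (derivative^[j] R).eval c = 0 := by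
  have h1 := pow_sub_dvd_iterate_derivative_of_pow_dvd j h
  exact dvd_iff_isRoot.1 ((dvd_pow_self _ (by omega)).trans h1)

/-- At e only the term in which every derivative falls on the power survives. -/
theorem Polynomial.eval_iterate_derivative_X_sub_C_pow_mul (e : ℝ) (l : ℕ) (q : Polynomial ℝ) :
    (derivative^[l] ((X - C e) ^ l * q)).eval e = l.factorial * q.eval e := by
  induction l generalizing q with
  | zero => simp
  | succ l ih =>
    have : derivative ((X - C e) ^ (l + 1) * q) =
        (X - C e) ^ l * (((l : Polynomial ℝ) + 1) * q + (X - C e) * derivative q) := by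
      rw [derivative_mul, derivative_X_sub_C_pow]
      simp
      ring
    rw [Function.iterate_succ_apply, this, ih, Nat.factorial_succ]
    simp
    ring

/-- Two coprime powers divide R, so their product of degree k + l divides a polynomial of smaller
degree. -/
theorem InterpolatesData.eq_zero {c e : ℝ} (hce : c ≠ e) {k l : ℕ} {R : Polynomial ℝ}
    (h : InterpolatesData c k e l 0 0 R) : R = 0 := by
  have h1 := Polynomial.X_sub_C_pow_dvd_of_eval_iterate_derivative h.2.1
  have h2 := Polynomial.X_sub_C_pow_dvd_of_eval_iterate_derivative h.2.2
  have h3 := IsCoprime.mul_dvd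
    ((Polynomial.isCoprime_X_sub_C_of_isUnit_sub (sub_ne_zero.2 hce).isUnit).pow) h1 h2
  refine Polynomial.eq_zero_of_dvd_of_degree_lt h3 (h.1.trans_eq ?_)
  simp [Polynomial.degree_mul, Polynomial.degree_pow]

theorem InterpolatesData.unique {c e : ℝ} (hce : c ≠ e) {k l : ℕ} {α β : ℕ → ℝ}
    {R R' : Polynomial ℝ} (h : InterpolatesData c k e l α β R)
    (h' : InterpolatesData c k e l α β R') : R = R' := by
  have := h.sub h'
  rw [sub_self, sub_self] at this
  exact sub_eq_zero.1 (this.eq_zero hce)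

/-- Interpolants exist, and can be chosen to depend continuously on the data. -/
theorem exists_interpolatesData {c e : ℝ} (hce : c ≠ e) (k l : ℕ) :
    ∃ T : (ℕ → ℝ) × (ℕ → ℝ) → Polynomial ℝ, (∀ D, InterpolatesData c k e l D.1 D.2 (T D)) ∧
      ∀ j x, Continuous fun D => (Polynomial.derivative^[j] (T D)).eval x := by
  have step : ∀ {c e : ℝ}, c ≠ e → ∀ k l : ℕ,
      (∃ T : (ℕ → ℝ) × (ℕ → ℝ) → Polynomial ℝ, (∀ D, InterpolatesData c k e l D.1 D.2 (T D)) ∧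
        ∀ j x, Continuous fun D => (Polynomial.derivative^[j] (T D)).eval x) →
      ∃ T : (ℕ → ℝ) × (ℕ → ℝ) → Polynomial ℝ,
        (∀ D, InterpolatesData c k e (l + 1) D.1 D.2 (T D)) ∧
        ∀ j x, Continuous fun D => (Polynomial.derivative^[j] (T D)).eval x := by
    rintro c e hce k l ⟨T, hT, hcont⟩
    -- W vanishes to order k at c and l at e, and its l-th derivative at e is l! (e - c)^k; adding t
    -- W thus meets the one new condition without disturbing the old ones.
    set W : Polynomial ℝ :=
      (Polynomial.X - Polynomial.C e) ^ l * (Polynomial.X - Polynomial.C c) ^ k with hW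
    set t : (ℕ → ℝ) × (ℕ → ℝ) → ℝ := fun D =>
      (D.2 l - (Polynomial.derivative^[l] (T D)).eval e) / (l.factorial * (e - c) ^ k) with ht
    have htcont : Continuous t := by
      have := hcont l e
      refine Continuous.div_const (Continuous.sub ?_ this) _
      fun_prop
    have hWdeg : W.degree = ((k + l : ℕ) : WithBot ℕ) := by
      simp [hW, Polynomial.degree_mul, Polynomial.degree_pow, add_comm]
    refine ⟨fun D => T D + Polynomial.C (t D) * W, fun D => ⟨?_, fun j hj => ?_, fun j hj => ?_⟩,
      fun j x => ?_⟩
    · have hlt : ((k + l : ℕ) : WithBot ℕ) < ((k + (l + 1) : ℕ) : WithBot ℕ) := by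
        exact_mod_cast (by omega : k + l < k + (l + 1))
      refine (Polynomial.degree_add_le _ _).trans_lt (max_lt ((hT D).1.trans hlt) ?_)
      rw [← Polynomial.smul_eq_C_mul]
      exact (Polynomial.degree_smul_le _ _).trans_lt (hWdeg.trans_lt hlt)
    · have := Polynomial.eval_iterate_derivative_of_X_sub_C_pow_dvd (R := W)
        (Dvd.intro_left _ rfl) hj
      simp [iterate_map_add, Polynomial.iterate_derivative_C_mul, this, (hT D).2.1 j hj]
    · rcases Nat.lt_succ_iff_lt_or_eq.1 hj with hj | rfl
      · have := Polynomial.eval_iterate_derivative_of_X_sub_C_pow_dvd (R := W)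
          (Dvd.intro _ rfl) hj
        simp [iterate_map_add, Polynomial.iterate_derivative_C_mul, this,
          (hT D).2.2 j hj]
      · have := Polynomial.eval_iterate_derivative_X_sub_C_pow_mul e j
          ((Polynomial.X - Polynomial.C c) ^ k)
        rw [← hW] at this
        have hne : (j.factorial : ℝ) * (e - c) ^ k ≠ 0 :=
          mul_ne_zero (by positivity) (pow_ne_zero _ (sub_ne_zero.2 hce.symm))
        simp only [iterate_map_add, Polynomial.iterate_derivative_C_mul,
          Polynomial.eval_add, Polynomial.eval_mul, Polynomial.eval_C, this, ht,
          Polynomial.eval_pow, Polynomial.eval_sub, Polynomial.eval_X]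
        field_simp
        ring
    · simp only [iterate_map_add, Polynomial.iterate_derivative_C_mul,
        Polynomial.eval_add, Polynomial.eval_mul, Polynomial.eval_C]
      exact (hcont j x).add (htcont.mul continuous_const)
  induction l with
  | succ l ih => exact step hce k l ih
  | zero =>
    induction k with
    | zero => exact ⟨fun _ => 0, fun D => ⟨by simp, by simp, by simp⟩, by simp [continuous_const]⟩
    | succ k ih =>
      obtain ⟨T, hT, hcont⟩ := ih
      -- Conditions at c are added by the same step with the nodes exchanged.
      obtain ⟨T', hT', hcont'⟩ := step hce.symm 0 k
        ⟨fun D => T D.swap, fun D => (hT D.swap).symm, fun j x =>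
          (hcont j x).comp continuous_swap⟩
      exact ⟨fun D => T' D.swap, fun D => (hT' D.swap).symm, fun j x =>
          (hcont' j x).comp continuous_swap⟩

theorem InterpolatesData.congr {c e : ℝ} {k l : ℕ} {α β α' β' : ℕ → ℝ} {R : Polynomial ℝ}
    (h : InterpolatesData c k e l α β R) (hα : ∀ j < k, α j = α' j) (hβ : ∀ j < l, β j = β' j) :
    InterpolatesData c k e l α' β' R :=
  ⟨h.1, fun j hj => (h.2.1 j hj).trans (hα j hj), fun j hj => (h.2.2 j hj).trans (hβ j hj)⟩

/-- Interpolation is continuous in its finitely many data; this is used for interpolants rescaled by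
one dominant derivative. -/
theorem InterpolatesData.tendsto_eval {ι : Type*} {L : Filter ι} {c e : ℝ} (hce : c ≠ e) {k l : ℕ}
    {α β : ι → ℕ → ℝ} {α' β' : ℕ → ℝ} {R : ι → Polynomial ℝ} {R' : Polynomial ℝ}
    (h : ∀ p, InterpolatesData c k e l (α p) (β p) (R p))
    (h' : InterpolatesData c k e l α' β' R')
    (hα : ∀ j < k, Tendsto (fun p => α p j) L (𝓝 (α' j)))
    (hβ : ∀ j < l, Tendsto (fun p => β p j) L (𝓝 (β' j))) (x : ℝ) :
    Tendsto (fun p => (R p).eval x) L (𝓝 (R'.eval x)) := by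
  obtain ⟨T, hT, hcont⟩ := exists_interpolatesData hce k l
  -- Convergence of data sequences is pointwise in every order, so orders beyond the prescribed ones
  -- are set to zero; by uniqueness this does not change the interpolant.
  have trunc : ∀ {k : ℕ} {α : ι → ℕ → ℝ} {α' : ℕ → ℝ},
      (∀ j < k, Tendsto (fun p => α p j) L (𝓝 (α' j))) →
      Tendsto (fun p j => if j < k then α p j else 0) L (𝓝 fun j => if j < k then α' j else 0) := by
    intro k α α' hα
    refine tendsto_pi_nhds.2 fun j => ?_
    by_cases hj : j < k
    · simpa [hj] using hα j hj
    · simp [hj, tendsto_const_nhds]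
  have hlim := ((hcont 0 x).tendsto _).comp ((trunc hα).prodMk_nhds (trunc hβ))
  have eq : ∀ {α β : ℕ → ℝ} {R : Polynomial ℝ}, InterpolatesData c k e l α β R →
      T (fun j => if j < k then α j else 0, fun j => if j < l then β j else 0) = R := by
    intro α β R hR
    refine ((hT _).congr (fun j hj => ?_) fun j hj => ?_).unique hce hR <;> simp [hj]
  simp only [Function.iterate_zero, id, eq h'] at hlim
  refine hlim.congr fun p => ?_
  simp only [Function.comp_apply, eq (h p)]

/-- This is the limit of the rescaled dominant interpolant: the constant normalises the l-th
derivative at e to 1. -/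
theorem interpolatesData_nodal {c e : ℝ} (hce : c ≠ e) (k l : ℕ) :
    InterpolatesData c k e (l + 1) 0 (Pi.single l 1)
      (Polynomial.C (1 / (l.factorial * (e - c) ^ k)) *
        ((Polynomial.X - Polynomial.C e) ^ l * (Polynomial.X - Polynomial.C c) ^ k)) := by
  have hne : (l.factorial : ℝ) * (e - c) ^ k ≠ 0 :=
    mul_ne_zero (by positivity) (pow_ne_zero _ (sub_ne_zero.2 hce.symm))
  refine ⟨?_, fun j hj => ?_, fun j hj => ?_⟩
  · rw [← Polynomial.smul_eq_C_mul]
    refine (Polynomial.degree_smul_le _ _).trans_lt ?_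
    rw [Polynomial.degree_mul, Polynomial.degree_pow, Polynomial.degree_pow,
      Polynomial.degree_X_sub_C, Polynomial.degree_X_sub_C]
    simp only [nsmul_eq_mul, mul_one]
    exact_mod_cast (by omega : l + k < k + (l + 1))
  · have := Polynomial.eval_iterate_derivative_of_X_sub_C_pow_dvd (c := c) (k := k)
      (R := (Polynomial.X - Polynomial.C e) ^ l * (Polynomial.X - Polynomial.C c) ^ k)
      (Dvd.intro_left _ rfl) hj
    rw [Polynomial.iterate_derivative_C_mul, Polynomial.eval_mul, this, mul_zero, Pi.zero_apply]
  · rcases Nat.lt_succ_iff_lt_or_eq.1 hj with hj | rfl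
    · have := Polynomial.eval_iterate_derivative_of_X_sub_C_pow_dvd (c := e) (k := l)
        (R := (Polynomial.X - Polynomial.C e) ^ l * (Polynomial.X - Polynomial.C c) ^ k)
        (Dvd.intro _ rfl) hj
      rw [Polynomial.iterate_derivative_C_mul, Polynomial.eval_mul, this, mul_zero,
        Pi.single_eq_of_ne hj.ne]
    · rw [Polynomial.iterate_derivative_C_mul, Polynomial.eval_mul, Polynomial.eval_C,
        Polynomial.eval_iterate_derivative_X_sub_C_pow_mul]
      simp only [Polynomial.eval_pow, Polynomial.eval_sub, Polynomial.eval_X, Polynomial.eval_C,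
        Pi.single_eq_same]
      exact one_div_mul_cancel hne

/-! ### Hermite interpolants of functions and the Hermite mean -/

theorem Polynomial.iteratedDeriv_eval (R : Polynomial ℝ) (j : ℕ) :
    iteratedDeriv j (fun x => R.eval x) = fun x => (derivative^[j] R).eval x := by
  induction j with
  | zero => simp
  | succ j ih =>
    rw [iteratedDeriv_succ, ih, Function.iterate_succ_apply']
    funext x
    exact Polynomial.deriv _

theorem isHermiteInterpolant_iff_interpolatesData {f : ℝ → ℝ} {a b : ℝ} {k l : ℕ}
    {R : Polynomial ℝ} : IsHermiteInterpolant f a k b l R ↔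
      InterpolatesData a (k + 1) b (l + 1) (fun j => iteratedDeriv j f a)
        (fun j => iteratedDeriv j f b) R := by
  unfold IsHermiteInterpolant InterpolatesData
  refine and_congr ?_ (by simp only [Nat.lt_succ_iff])
  rw [Polynomial.natDegree_le_iff_degree_le, Polynomial.degree_le_iff_coeff_zero,
    Polynomial.degree_lt_iff_coeff_zero]
  refine forall_congr' fun m => ?_
  rw [Nat.cast_lt, show k + 1 + (l + 1) = (k + l + 1) + 1 by ring, Nat.succ_le_iff]

theorem exists_isHermiteInterpolant (f : ℝ → ℝ) {a b : ℝ} (hab : a ≠ b) (k l : ℕ) :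
    ∃ R, IsHermiteInterpolant f a k b l R := by
  obtain ⟨T, hT, -⟩ := exists_interpolatesData hab (k + 1) (l + 1)
  exact ⟨_, isHermiteInterpolant_iff_interpolatesData.2
    (hT (fun j => iteratedDeriv j f a, fun j => iteratedDeriv j f b))⟩

theorem IsHermiteInterpolant.unique {f : ℝ → ℝ} {a b : ℝ} (hab : a ≠ b) {k l : ℕ}
    {R R' : Polynomial ℝ} (h : IsHermiteInterpolant f a k b l R)
    (h' : IsHermiteInterpolant f a k b l R') : R = R' :=
  (isHermiteInterpolant_iff_interpolatesData.1 h).unique hab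
    (isHermiteInterpolant_iff_interpolatesData.1 h')

theorem IsHermiteInterpolant.symm {f : ℝ → ℝ} {a b : ℝ} {k l : ℕ} {R : Polynomial ℝ}
    (h : IsHermiteInterpolant f a k b l R) : IsHermiteInterpolant f b l a k R :=
  ⟨by rw [add_comm l k]; exact h.1, h.2.2, h.2.1⟩

theorem IsHermiteMeanPoint.symm {f : ℝ → ℝ} {m₁ m₂ : ℕ} {a b x : ℝ}
    (h : IsHermiteMeanPoint f m₁ m₂ a b x) : IsHermiteMeanPoint f m₁ m₂ b a x := by
  obtain ⟨hx, P, Q, hP, hQ, he, ho⟩ := h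
  refine ⟨by rwa [min_comm, max_comm], Q, P, hQ.symm, hP.symm, fun h => (he h).symm, fun h => ?_⟩
  rw [ho h, add_comm]

theorem hermiteMean_comm (f : ℝ → ℝ) (m₁ m₂ : ℕ) (a b : ℝ) :
    hermiteMean f m₁ m₂ a b = hermiteMean f m₁ m₂ b a := by
  rcases eq_or_ne a b with rfl | hab
  · rfl
  have : IsHermiteMeanPoint f m₁ m₂ a b = IsHermiteMeanPoint f m₁ m₂ b a :=
    funext fun x => propext ⟨fun h => h.symm, fun h => h.symm⟩
  unfold hermiteMean
  rw [if_neg hab, if_neg hab.symm]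
  revert this
  generalize IsHermiteMeanPoint f m₁ m₂ a b = u
  rintro rfl
  rfl

theorem isHermiteMeanPoint_hermiteMean {f : ℝ → ℝ} {m₁ m₂ : ℕ} {a b : ℝ} (hab : a ≠ b)
    (h : ∃! x, IsHermiteMeanPoint f m₁ m₂ a b x) :
    IsHermiteMeanPoint f m₁ m₂ a b (hermiteMean f m₁ m₂ a b) := by
  rw [hermiteMean, if_neg hab, dif_pos h]
  exact h.choose_spec.1

theorem iteratedDeriv_const_mul_sub_polynomial {f : ℝ → ℝ} {x : ℝ} (hf : AnalyticAt ℝ f x)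
    (σ : ℝ) (P : Polynomial ℝ) (j : ℕ) :
    iteratedDeriv j (fun t => σ * (f t - P.eval t)) x =
      σ * (iteratedDeriv j f x - (Polynomial.derivative^[j] P).eval x) := by
  have h : iteratedDeriv j (f - fun t => P.eval t) x =
      iteratedDeriv j f x - iteratedDeriv j (fun t => P.eval t) x :=
    iteratedDeriv_sub hf.contDiffAt (AnalyticOnNhd.eval_polynomial P x trivial).contDiffAt
  rw [Polynomial.iteratedDeriv_eval] at h
  rw [← h]
  exact iteratedDeriv_const_mul_field σ (f - fun t => P.eval t)

/-- The mean lies strictly between `a` and `b`, and its position relative to `y` is decided by the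
sign of an expression in the interpolation errors at `y`. -/
theorem hermiteMean_mem_Ioo_and_position {f : ℝ → ℝ} (hf : AnalyticOnNhd ℝ f (Set.Ioi 0))
    {m₁ m₂ : ℕ} (hm : m₂ < m₁) {a b : ℝ} (ha : 0 < a) (hab : a < b) {σ : ℝ}
    (hpos : ∀ x ∈ Set.Ioi (0 : ℝ), 0 < σ * iteratedDeriv (m₁ + m₂ + 2) f x) {P Q : Polynomial ℝ}
    (hP : IsHermiteInterpolant f a m₁ b m₂ P) (hQ : IsHermiteInterpolant f a m₂ b m₁ Q) :
    hermiteMean f m₁ m₂ a b ∈ Set.Ioo a b ∧ ∀ y ∈ Set.Ioo a b,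
      (σ * ((f y - P.eval y) - (-1) ^ (m₁ - m₂) * (f y - Q.eval y)) *
        ((y - a) ^ (m₂ + 1) * (y - b) ^ (m₂ + 1)) < 0 → y < hermiteMean f m₁ m₂ a b) ∧
      (0 < σ * ((f y - P.eval y) - (-1) ^ (m₁ - m₂) * (f y - Q.eval y)) *
        ((y - a) ^ (m₂ + 1) * (y - b) ^ (m₂ + 1)) → hermiteMean f m₁ m₂ a b < y) := by
  obtain ⟨D, hD⟩ : ∃ D, m₁ - m₂ = D + 1 := ⟨m₁ - m₂ - 1, by omega⟩
  have hb : 0 < b := ha.trans hab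
  have hσ : σ ≠ 0 := by
    rintro rfl
    simpa using hpos a ha
  have analytic : ∀ R : Polynomial ℝ,
      AnalyticOnNhd ℝ (fun t => σ * (f t - R.eval t)) (Set.Ioi 0) := fun R x hx =>
    analyticAt_const.mul ((hf x hx).sub (AnalyticOnNhd.eval_polynomial R x trivial))
  have vanish : ∀ {R : Polynomial ℝ} {c : ℝ} {k : ℕ}, 0 < c →
      (∀ j ≤ k, (Polynomial.derivative^[j] R).eval c = iteratedDeriv j f c) →
      ∀ j < k + 1, iteratedDeriv j (fun t => σ * (f t - R.eval t)) c = 0 := by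
    intro R c k hc hR j hj
    rw [iteratedDeriv_const_mul_sub_polynomial (hf c hc), hR j (by omega), sub_self, mul_zero]
  have positive : ∀ {R : Polynomial ℝ}, R.natDegree ≤ m₁ + m₂ + 1 → ∀ x ∈ Set.Ioi (0 : ℝ),
      0 < iteratedDeriv (D + 1 + (m₂ + 1) + (m₂ + 1)) (fun t => σ * (f t - R.eval t)) x := by
    intro R hR x hx
    rw [show D + 1 + (m₂ + 1) + (m₂ + 1) = m₁ + m₂ + 2 by omega,
      iteratedDeriv_const_mul_sub_polynomial (hf x hx),
      Polynomial.iterate_derivative_eq_zero (by omega), Polynomial.eval_zero, sub_zero]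
    exact hpos x hx
  have h1 : m₂ + 1 + (D + 1) = m₁ + 1 := by omega
  obtain ⟨E, hEcont, hEmono, hEa, hEb, hE⟩ := exists_strictMonoOn_eq_nodal_mul isOpen_Ioi
    Set.ordConnected_Ioi (analytic P) (analytic Q) ha hb hab (m₂ + 1) D
    (by rw [h1]; exact vanish ha hP.2.1) (vanish hb hP.2.2) (vanish ha hQ.2.1)
    (by rw [h1]; exact vanish hb hQ.2.2) (positive hP.1)
    (positive (hQ.1.trans_eq (by rw [add_comm m₂ m₁])))
  have hne : ∀ y ∈ Set.Ioo a b, (y - a) ^ (m₂ + 1) * (y - b) ^ (m₂ + 1) ≠ 0 := fun y hy =>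
    mul_ne_zero (pow_ne_zero _ (sub_ne_zero.2 hy.1.ne')) (pow_ne_zero _ (sub_ne_zero.2 hy.2.ne))
  have hE' : ∀ y, σ * ((f y - P.eval y) - (-1) ^ (m₁ - m₂) * (f y - Q.eval y)) =
      (y - a) ^ (m₂ + 1) * (y - b) ^ (m₂ + 1) * E y := by
    intro y
    rw [← hE y, hD]; ring
  have hzero : ∀ y ∈ Set.Ioo a b,
      (E y = 0 ↔ (f y - P.eval y) - (-1) ^ (m₁ - m₂) * (f y - Q.eval y) = 0) := by
    intro y hy
    have := hE' y
    constructor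
    · intro h0
      rw [h0, mul_zero] at this
      exact (mul_eq_zero.1 this).resolve_left hσ
    · intro h0
      rw [h0, mul_zero] at this
      exact (mul_eq_zero.1 this.symm).resolve_left (hne y hy)
  -- For even m₁ - m₂ the values of f cancel and leave P = Q; for odd m₁ - m₂ the two errors must
  -- sum to zero.
  have hpoint : ∀ y, IsHermiteMeanPoint f m₁ m₂ a b y ↔ y ∈ Set.Ioo a b ∧ E y = 0 := by
    intro y
    unfold IsHermiteMeanPoint
    rw [min_eq_left hab.le, max_eq_right hab.le]
    refine and_congr_right fun hy => ?_
    rw [hzero y hy]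
    constructor
    · rintro ⟨P', Q', hP', hQ', he, ho⟩
      rw [hP'.unique hab.ne hP, hQ'.unique hab.ne hQ] at he ho
      rcases Nat.even_or_odd (m₁ - m₂) with h | h
      · rw [h.neg_one_pow, he h]; ring
      · rw [h.neg_one_pow, ho h]; ring
    · intro h0
      refine ⟨P, Q, hP, hQ, fun h => ?_, fun h => ?_⟩
      · rw [h.neg_one_pow] at h0; linarith
      · rw [h.neg_one_pow] at h0; linarith
  obtain ⟨x₀, hx₀, hEx₀⟩ : ∃ x₀ ∈ Set.Ioo a b, E x₀ = 0 :=
    intermediate_value_Ioo hab.le hEcont ⟨hEa, hEb⟩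
  have huniq : ∃! x, IsHermiteMeanPoint f m₁ m₂ a b x := by
    refine ⟨x₀, (hpoint x₀).2 ⟨hx₀, hEx₀⟩, fun y hy => ?_⟩
    obtain ⟨hy, hEy⟩ := (hpoint y).1 hy
    exact hEmono.injOn (Set.Ioo_subset_Icc_self hy) (Set.Ioo_subset_Icc_self hx₀)
      (hEy.trans hEx₀.symm)
  obtain ⟨hM, hEM⟩ := (hpoint _).1 (isHermiteMeanPoint_hermiteMean hab.ne huniq)
  refine ⟨hM, fun y hy => ?_⟩
  -- The extra nodal factor in the statement completes a square, so the expression has the sign of E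
  -- y.
  have hsq := mul_self_pos.2 (hne y hy)
  rw [hE', mul_right_comm]
  refine ⟨fun h => ?_, fun h => ?_⟩
  · have hlt : E y < 0 := by
      by_contra! hc
      exact absurd h (not_lt.2 (mul_nonneg hsq.le hc))
    rw [← hEM] at hlt
    exact (hEmono.lt_iff_lt (Set.Ioo_subset_Icc_self hy) (Set.Ioo_subset_Icc_self hM)).1 hlt
  · have hlt : 0 < E y := pos_of_mul_pos_right h hsq.le
    rw [← hEM] at hlt
    exact (hEmono.lt_iff_lt (Set.Ioo_subset_Icc_self hM) (Set.Ioo_subset_Icc_self hy)).1 hlt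

/-! ### Power functions -/

theorem analyticOnNhd_rpow_const (p : ℝ) :
    AnalyticOnNhd ℝ (fun x : ℝ => x ^ p) (Set.Ioi 0) := by
  intro x hx
  have h : AnalyticAt ℝ (fun y : ℝ => Real.exp (Real.log y * p)) x :=
    ((analyticAt_log hx).mul analyticAt_const).rexp
  refine h.congr ?_
  filter_upwards [isOpen_Ioi.mem_nhds hx] with y hy
  exact (Real.rpow_def_of_pos hy p).symm

theorem iteratedDeriv_rpow (p x : ℝ) (j : ℕ) :
    iteratedDeriv j (fun t : ℝ => t ^ p) x = (descPochhammer ℝ j).eval p * x ^ (p - j) := by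
  rw [iteratedDeriv_eq_iterate, Real.iter_deriv_rpow_const]

theorem descPochhammer_eval_succ (j : ℕ) (p : ℝ) :
    (descPochhammer ℝ (j + 1)).eval p = (descPochhammer ℝ j).eval p * (p - j) := by
  simp [descPochhammer_succ_right]

theorem descPochhammer_eval_pos_of_gt {j : ℕ} {p : ℝ} (h : (j : ℝ) < p) :
    0 < (descPochhammer ℝ j).eval p := by
  induction j with
  | zero => simp
  | succ j ih =>
    push_cast at h
    rw [descPochhammer_eval_succ]
    exact mul_pos (ih (by linarith)) (by linarith)

theorem neg_one_pow_mul_descPochhammer_eval_pos {p : ℝ} (h : p < 0) (j : ℕ) :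
    0 < (-1) ^ j * (descPochhammer ℝ j).eval p := by
  induction j with
  | zero => simp
  | succ j ih =>
    have hj : 0 < (j : ℝ) - p := by have : (0 : ℝ) ≤ j := j.cast_nonneg; linarith
    have := mul_pos ih hj
    rw [descPochhammer_eval_succ, pow_succ]
    linarith

/-- The quotient is a product of factors 1/(p - i). A general filter serves both p → ∞ and p → -∞.
-/
theorem isBigO_descPochhammer_div {L : Filter ℝ}
    (hL : ∀ i : ℕ, Tendsto (fun p : ℝ => (p - i)⁻¹) L (𝓝 0)) {j m : ℕ} (hjm : j ≤ m) :
    (fun p => (descPochhammer ℝ j).eval p / (descPochhammer ℝ m).eval p) =O[L]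
      fun _ => (1 : ℝ) := by
  induction m, hjm using Nat.le_induction with
  | base =>
    -- The bound 1 also covers zeros of the denominator, where the quotient is 0 by convention.
    refine Asymptotics.IsBigO.of_bound 1 (Eventually.of_forall fun p => ?_)
    rcases eq_or_ne ((descPochhammer ℝ j).eval p) 0 with h | h <;> simp [h]
  | succ m hm ih =>
    have := ih.mul ((hL m).isBigO_one ℝ)
    simp only [mul_one] at this
    refine this.congr_left fun p => ?_
    rw [descPochhammer_eval_succ, div_mul_eq_div_div, div_eq_mul_inv _ (p - m)]

theorem tendsto_descPochhammer_div {L : Filter ℝ}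
    (hL : ∀ i : ℕ, Tendsto (fun p : ℝ => (p - i)⁻¹) L (𝓝 0)) {j m : ℕ} (hjm : j < m) :
    Tendsto (fun p => (descPochhammer ℝ j).eval p / (descPochhammer ℝ m).eval p) L (𝓝 0) := by
  obtain ⟨m, rfl⟩ : ∃ i, m = i + 1 := ⟨m - 1, by omega⟩
  rw [← Asymptotics.isLittleO_one_iff ℝ]
  have := (isBigO_descPochhammer_div hL (Nat.lt_succ_iff.1 hjm)).mul_isLittleO
    ((Asymptotics.isLittleO_one_iff ℝ).2 (hL m))
  simp only [mul_one] at this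
  refine this.congr_left fun p => ?_
  rw [descPochhammer_eval_succ, div_mul_eq_div_div, div_eq_mul_inv _ (p - m)]

/-- The quotient separates into a rational function of p, an exponential in p and a constant. -/
theorem iteratedDeriv_rpow_div {c e : ℝ} (hc : 0 < c) (he : 0 < e) (j m : ℕ) (p : ℝ) :
    iteratedDeriv j (fun t : ℝ => t ^ p) c / iteratedDeriv m (fun t : ℝ => t ^ p) e =
      (descPochhammer ℝ j).eval p / (descPochhammer ℝ m).eval p * (c / e) ^ p *
        (e ^ m / c ^ j) := by
  rw [iteratedDeriv_rpow, iteratedDeriv_rpow, Real.rpow_sub hc, Real.rpow_sub he,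
    Real.rpow_natCast, Real.rpow_natCast, Real.div_rpow hc.le he.le]
  rcases eq_or_ne ((descPochhammer ℝ m).eval p) 0 with h | h
  · simp [h]
  have := (Real.rpow_pos_of_pos he p).ne'
  field_simp

/-- Derivatives at `c` are negligible compared with a fixed derivative at the dominating
point `e`. -/
theorem tendsto_iteratedDeriv_rpow_div_of_ne {L : Filter ℝ}
    (hL : ∀ i : ℕ, Tendsto (fun p : ℝ => (p - i)⁻¹) L (𝓝 0)) {c e : ℝ} (hc : 0 < c) (he : 0 < e)
    (hce : Tendsto (fun p : ℝ => (c / e) ^ p) L (𝓝 0)) {j m : ℕ} (hjm : j ≤ m) :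
    Tendsto (fun p => iteratedDeriv j (fun t : ℝ => t ^ p) c /
      iteratedDeriv m (fun t : ℝ => t ^ p) e) L (𝓝 0) := by
  simp only [iteratedDeriv_rpow_div hc he]
  have := (isBigO_descPochhammer_div hL hjm).mul_isLittleO
    ((Asymptotics.isLittleO_one_iff ℝ).2 hce)
  simp only [mul_one] at this
  simpa using ((Asymptotics.isLittleO_one_iff ℝ).1 this).mul_const (e ^ m / c ^ j)

theorem tendsto_iteratedDeriv_rpow_div_self {L : Filter ℝ}
    (hL : ∀ i : ℕ, Tendsto (fun p : ℝ => (p - i)⁻¹) L (𝓝 0)) {e : ℝ} (he : 0 < e)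
    {j m : ℕ} (hjm : j < m) :
    Tendsto (fun p => iteratedDeriv j (fun t : ℝ => t ^ p) e /
      iteratedDeriv m (fun t : ℝ => t ^ p) e) L (𝓝 0) := by
  simp only [iteratedDeriv_rpow_div he he, div_self he.ne', Real.one_rpow, mul_one]
  simpa using (tendsto_descPochhammer_div hL hjm).mul_const (e ^ m / e ^ j)

/-- After division by the derivative of order `m₁` at the dominating point `e`, the interpolant
that uses this derivative tends to a nodal polynomial, and the other one tends to zero, as does
the function itself. -/
theorem tendsto_rpow_interpolants_div {L : Filter ℝ}
    (hL : ∀ i : ℕ, Tendsto (fun p : ℝ => (p - i)⁻¹) L (𝓝 0)) {c e y : ℝ} (hc : 0 < c) (he : 0 < e)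
    (hy : 0 < y) (hce : c ≠ e) (hc0 : Tendsto (fun p : ℝ => (c / e) ^ p) L (𝓝 0))
    (hy0 : Tendsto (fun p : ℝ => (y / e) ^ p) L (𝓝 0)) {m₁ m₂ : ℕ} (hm : m₂ < m₁)
    (hne : ∀ᶠ p in L, iteratedDeriv m₁ (fun t : ℝ => t ^ p) e ≠ 0) {R U : ℝ → Polynomial ℝ}
    (hR : ∀ p, IsHermiteInterpolant (fun t => t ^ p) c m₁ e m₂ (R p))
    (hU : ∀ p, IsHermiteInterpolant (fun t => t ^ p) c m₂ e m₁ (U p)) :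
    Tendsto (fun p => y ^ p / iteratedDeriv m₁ (fun t : ℝ => t ^ p) e) L (𝓝 0) ∧
    Tendsto (fun p => (R p).eval y / iteratedDeriv m₁ (fun t : ℝ => t ^ p) e) L (𝓝 0) ∧
    Tendsto (fun p => (U p).eval y / iteratedDeriv m₁ (fun t : ℝ => t ^ p) e) L
      (𝓝 ((y - e) ^ m₁ * (y - c) ^ (m₂ + 1) / (m₁.factorial * (e - c) ^ (m₂ + 1)))) := by
  refine ⟨?_, ?_, ?_⟩
  · simpa using tendsto_iteratedDeriv_rpow_div_of_ne hL hy he hy0 (Nat.zero_le m₁)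
  · have h := InterpolatesData.tendsto_eval (L := L) (R' := 0) (α' := 0) (β' := 0) hce
      (fun p => (isHermiteInterpolant_iff_interpolatesData.1 (hR p)).C_mul
        (iteratedDeriv m₁ (fun t : ℝ => t ^ p) e)⁻¹) ⟨by simp, by simp, by simp⟩
      (fun j hj => by
        simpa [inv_mul_eq_div] using
          tendsto_iteratedDeriv_rpow_div_of_ne hL hc he hc0 (Nat.lt_succ_iff.1 hj))
      (fun j hj => by
        simpa [inv_mul_eq_div] using
          tendsto_iteratedDeriv_rpow_div_self hL he (by omega : j < m₁)) y
    simpa [inv_mul_eq_div] using h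
  · have h := InterpolatesData.tendsto_eval (L := L) hce
      (fun p => (isHermiteInterpolant_iff_interpolatesData.1 (hU p)).C_mul
        (iteratedDeriv m₁ (fun t : ℝ => t ^ p) e)⁻¹) (interpolatesData_nodal hce (m₂ + 1) m₁)
      (fun j hj => by
        simpa [inv_mul_eq_div] using
          tendsto_iteratedDeriv_rpow_div_of_ne hL hc he hc0 (by omega : j ≤ m₁))
      (fun j hj => by
        rcases Nat.lt_succ_iff_lt_or_eq.1 hj with hj | rfl
        · simpa [inv_mul_eq_div, hj.ne] using tendsto_iteratedDeriv_rpow_div_self hL he hj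
        · rw [Pi.single_eq_same]
          refine tendsto_const_nhds.congr' ?_
          filter_upwards [hne] with p hp
          exact (inv_mul_cancel₀ hp).symm) y
    convert h using 2
    · simp [inv_mul_eq_div]
    · simp only [Polynomial.eval_mul, Polynomial.eval_C, Polynomial.eval_pow, Polynomial.eval_sub,
        Polynomial.eval_X]
      ring

/-! ### The limits of the mean as p → ±∞ -/

theorem tendsto_powerHermiteMean_of_lt {m₁ m₂ : ℕ} (hm : m₂ < m₁) {a b : ℝ} (ha : 0 < a)
    (hab : a < b) :
    Tendsto (fun p : ℝ => powerHermiteMean p m₁ m₂ a b) atTop (𝓝 b) ∧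
    Tendsto (fun p : ℝ => powerHermiteMean p m₁ m₂ a b) atBot (𝓝 a) := by
  have hb : 0 < b := ha.trans hab
  choose P hP using fun p : ℝ => exists_isHermiteInterpolant (fun t => t ^ p) hab.ne m₁ m₂
  choose Q hQ using fun p : ℝ => exists_isHermiteInterpolant (fun t => t ^ p) hab.ne m₂ m₁
  have htop : ∀ i : ℕ, Tendsto (fun p : ℝ => (p - i)⁻¹) atTop (𝓝 0) := fun i =>
    tendsto_inv_atTop_zero.comp (tendsto_atTop_add_const_right _ _ tendsto_id)
  have hbot : ∀ i : ℕ, Tendsto (fun p : ℝ => (p - i)⁻¹) atBot (𝓝 0) := fun i =>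
    tendsto_inv_atBot_zero.comp (tendsto_atBot_add_const_right _ _ tendsto_id)
  have mean_top : ∀ᶠ p : ℝ in atTop, powerHermiteMean p m₁ m₂ a b ∈ Set.Ioo a b ∧
      ∀ y ∈ Set.Ioo a b, ((y ^ p - (P p).eval y) - (-1) ^ (m₁ - m₂) * (y ^ p - (Q p).eval y)) *
        ((y - a) ^ (m₂ + 1) * (y - b) ^ (m₂ + 1)) < 0 → y < powerHermiteMean p m₁ m₂ a b := by
    -- Beyond this bound p avoids the logarithmic exponents and every factor of the derivative of
    -- order n + 1 is positive, so σ = 1.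
    filter_upwards [eventually_gt_atTop ((m₁ + m₂ + 2 : ℕ) : ℝ)] with p hp
    have hfun : powerFun (m₁ + m₂ + 1) p = fun x => x ^ p := by
      refine if_neg ?_
      rintro ⟨k, hk, rfl⟩
      exact absurd (Nat.cast_lt.1 hp) (by omega)
    have h := hermiteMean_mem_Ioo_and_position (analyticOnNhd_rpow_const p) hm ha hab (σ := 1)
      (fun x hx => by
        rw [one_mul, iteratedDeriv_rpow]
        exact mul_pos (descPochhammer_eval_pos_of_gt hp) (Real.rpow_pos_of_pos hx _)) (hP p) (hQ p)
    rw [powerHermiteMean, hfun]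
    refine ⟨h.1, fun y hy hlt => (h.2 y hy).1 ?_⟩
    rwa [one_mul]
  have mean_bot : ∀ᶠ p : ℝ in atBot, powerHermiteMean p m₁ m₂ a b ∈ Set.Ioo a b ∧
      ∀ y ∈ Set.Ioo a b, 0 < (-1) ^ (m₁ + m₂) *
        ((y ^ p - (P p).eval y) - (-1) ^ (m₁ - m₂) * (y ^ p - (Q p).eval y)) *
        ((y - a) ^ (m₂ + 1) * (y - b) ^ (m₂ + 1)) → powerHermiteMean p m₁ m₂ a b < y := by
    -- For p < 0 there is no logarithm, and the derivative of order n + 1 has sign (-1)^(m₁+m₂+2) =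
    -- (-1)^(m₁+m₂).
    filter_upwards [eventually_lt_atBot (0 : ℝ)] with p hp
    have hfun : powerFun (m₁ + m₂ + 1) p = fun x => x ^ p := by
      refine if_neg ?_
      rintro ⟨k, hk, rfl⟩
      exact absurd hp (not_lt.2 k.cast_nonneg)
    have h := hermiteMean_mem_Ioo_and_position (analyticOnNhd_rpow_const p) hm ha hab
      (σ := (-1) ^ (m₁ + m₂))
      (fun x hx => by
        have h1 := neg_one_pow_mul_descPochhammer_eval_pos hp (m₁ + m₂ + 2)
        rw [pow_add _ (m₁ + m₂) 2, neg_one_sq, mul_one] at h1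
        rw [iteratedDeriv_rpow, ← mul_assoc]
        exact mul_pos h1 (Real.rpow_pos_of_pos hx _)) (hP p) (hQ p)
    rw [powerHermiteMean, hfun]
    exact ⟨h.1, fun y hy hlt => (h.2 y hy).2 hlt⟩
  have after : ∀ y ∈ Set.Ioo a b, ∀ᶠ p : ℝ in atTop, y < powerHermiteMean p m₁ m₂ a b := by
    intro y hy
    have hγ : ∀ᶠ p : ℝ in atTop, 0 < iteratedDeriv m₁ (fun t : ℝ => t ^ p) b := by
      filter_upwards [eventually_gt_atTop (m₁ : ℝ)] with p hp
      rw [iteratedDeriv_rpow]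
      exact mul_pos (descPochhammer_eval_pos_of_gt hp) (Real.rpow_pos_of_pos hb _)
    have ratio : ∀ c, 0 < c → c < b → Tendsto (fun p : ℝ => (c / b) ^ p) atTop (𝓝 0) :=
      fun c hc hcb => tendsto_rpow_atTop_of_base_lt_one _
        (by linarith [div_pos hc hb]) ((div_lt_one hb).2 hcb)
    obtain ⟨hf, hPlim, hQlim⟩ := tendsto_rpow_interpolants_div htop ha hb (ha.trans hy.1) hab.ne
      (ratio a ha hab) (ratio y (ha.trans hy.1) hy.2) hm (hγ.mono fun p h => h.ne') hP hQ
    have hlim := ((hf.sub hPlim).sub ((hf.sub hQlim).const_mul ((-1) ^ (m₁ - m₂)))).mul_const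
      ((y - a) ^ (m₂ + 1) * (y - b) ^ (m₂ + 1))
    -- The powers of y - b together with (-1)^(m₁-m₂) contribute the sign (-1)^(2m₁+1) = -1.
    have hneg : (0 - 0 - (-1) ^ (m₁ - m₂) * (0 - (y - b) ^ m₁ * (y - a) ^ (m₂ + 1) /
        (m₁.factorial * (b - a) ^ (m₂ + 1)))) * ((y - a) ^ (m₂ + 1) * (y - b) ^ (m₂ + 1)) < 0 := by
      obtain ⟨d, rfl⟩ : ∃ d, m₁ = m₂ + d := ⟨m₁ - m₂, by omega⟩
      have h1 : 0 < y - a := sub_pos.2 hy.1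
      have h2 : 0 < b - y := sub_pos.2 hy.2
      have h3 : 0 < b - a := sub_pos.2 hab
      have : (0 - 0 - (-1) ^ (m₂ + d - m₂) * (0 - (y - b) ^ (m₂ + d) * (y - a) ^ (m₂ + 1) /
          ((m₂ + d).factorial * (b - a) ^ (m₂ + 1)))) *
          ((y - a) ^ (m₂ + 1) * (y - b) ^ (m₂ + 1)) =
          -((b - y) ^ (2 * m₂ + 1 + d) * ((y - a) ^ (m₂ + 1)) ^ 2 /
            ((m₂ + d).factorial * (b - a) ^ (m₂ + 1))) := by
        have e1 : y - b = (-1) * (b - y) := by ring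
        have e2 : ((-1 : ℝ) ^ d) ^ 2 = 1 := by rw [← pow_mul, mul_comm, pow_mul]; simp
        have e3 : ((-1 : ℝ) ^ m₂) ^ 2 = 1 := by rw [← pow_mul, mul_comm, pow_mul]; simp
        rw [Nat.add_sub_cancel_left, e1, mul_pow, mul_pow]
        simp only [pow_add, two_mul, pow_one]
        linear_combination (-((b - y) ^ m₂ * (b - y) ^ m₂ * (b - y) * (b - y) ^ d *
          ((y - a) ^ m₂ * (y - a)) ^ 2 / ((m₂ + d).factorial * ((b - a) ^ m₂ * (b - a))))) *
          (((-1 : ℝ) ^ d) ^ 2 * e3 + e2)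
      rw [this, neg_lt_zero]
      positivity
    filter_upwards [mean_top, hγ, hlim.eventually_lt_const hneg] with p hp hγp hlt
    refine hp.2 y hy ?_
    refine (mul_neg_of_pos_of_neg hγp hlt).trans_eq' ?_
    field_simp
  have before : ∀ y ∈ Set.Ioo a b, ∀ᶠ p : ℝ in atBot, powerHermiteMean p m₁ m₂ a b < y := by
    intro y hy
    have hγ : ∀ᶠ p : ℝ in atBot, 0 < (-1) ^ m₁ * iteratedDeriv m₁ (fun t : ℝ => t ^ p) a := by
      filter_upwards [eventually_lt_atBot (0 : ℝ)] with p hp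
      rw [iteratedDeriv_rpow, ← mul_assoc]
      exact mul_pos (neg_one_pow_mul_descPochhammer_eval_pos hp m₁) (Real.rpow_pos_of_pos ha _)
    have ratio : ∀ c, a < c → Tendsto (fun p : ℝ => (c / a) ^ p) atBot (𝓝 0) :=
      fun c hc => tendsto_rpow_atBot_of_base_gt_one _ ((one_lt_div ha).2 hc)
    -- Here a is the dominating node, so P, which uses order m₁ at a, has the nodal limit and Q
    -- becomes negligible.
    obtain ⟨hf, hQlim, hPlim⟩ := tendsto_rpow_interpolants_div hbot hb ha (ha.trans hy.1) hab.ne'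
      (ratio b hab) (ratio y hy.1) hm (hγ.mono fun p h h0 => by simp [h0] at h)
      (fun p => (hQ p).symm) (fun p => (hP p).symm)
    -- The sign (-1)^(m₁+m₂) in `mean_bot` is split: (-1)^m₁ makes the divisor positive, and (-1)^m₂
    -- stays with the limit.
    have hlim := (((hf.sub hPlim).sub ((hf.sub hQlim).const_mul ((-1) ^ (m₁ - m₂)))).const_mul
      ((-1) ^ m₂)).mul_const ((y - a) ^ (m₂ + 1) * (y - b) ^ (m₂ + 1))
    have hpos : 0 < (-1) ^ m₂ * (0 - (y - a) ^ m₁ * (y - b) ^ (m₂ + 1) /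
        (m₁.factorial * (a - b) ^ (m₂ + 1)) - (-1) ^ (m₁ - m₂) * (0 - 0)) *
        ((y - a) ^ (m₂ + 1) * (y - b) ^ (m₂ + 1)) := by
      have h1 : 0 < y - a := sub_pos.2 hy.1
      have h2 : 0 < b - y := sub_pos.2 hy.2
      have h3 : 0 < b - a := sub_pos.2 hab
      have : (-1) ^ m₂ * (0 - (y - a) ^ m₁ * (y - b) ^ (m₂ + 1) /
          (m₁.factorial * (a - b) ^ (m₂ + 1)) - (-1) ^ (m₁ - m₂) * (0 - 0)) *
          ((y - a) ^ (m₂ + 1) * (y - b) ^ (m₂ + 1)) =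
          (y - a) ^ m₁ * (y - a) ^ (m₂ + 1) * ((b - y) ^ (m₂ + 1)) ^ 2 /
            (m₁.factorial * (b - a) ^ (m₂ + 1)) := by
        have e1 : y - b = (-1) * (b - y) := by ring
        have e2 : a - b = (-1) * (b - a) := by ring
        have e3 : (-1 : ℝ) ^ m₂ ≠ 0 := by simp
        have e4 : (b - a) ^ (m₂ + 1) ≠ 0 := (pow_pos h3 _).ne'
        have e5 : ((-1 : ℝ) ^ m₂) ^ 2 = 1 := by rw [← pow_mul, mul_comm, pow_mul]; simp
        rw [e1, e2, mul_pow, mul_pow, pow_succ (-1 : ℝ)]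
        field_simp
        linear_combination (b - y) ^ (m₂ + 1) * (y - a) ^ m₁ * e5
      rw [this]
      positivity
    filter_upwards [mean_bot, hγ, hlim.eventually_const_lt hpos] with p hp hγp hlt
    refine hp.2 y hy ?_
    have hne : iteratedDeriv m₁ (fun t : ℝ => t ^ p) a ≠ 0 := fun h0 => by simp [h0] at hγp
    refine (mul_pos hγp hlt).trans_eq ?_
    field_simp
    ring
  refine ⟨tendsto_order.2 ⟨fun y hy => ?_, fun y hy => ?_⟩,
    tendsto_order.2 ⟨fun y hy => ?_, fun y hy => ?_⟩⟩
  -- The given y may lie to the left of a, whereas `after` needs a point of (a, b).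
  · obtain ⟨z, hz1, hz2⟩ := exists_between (max_lt hab hy)
    filter_upwards [after z ⟨(le_max_left _ _).trans_lt hz1, hz2⟩] with p hp
    exact ((le_max_right _ _).trans_lt hz1).trans hp
  · filter_upwards [mean_top] with p hp
    exact hp.1.2.trans hy
  · filter_upwards [mean_bot] with p hp
    exact hy.trans hp.1.1
  · obtain ⟨z, hz1, hz2⟩ := exists_between (lt_min hab hy)
    filter_upwards [before z ⟨hz1, hz2.trans_le (min_le_left _ _)⟩] with p hp
    exact hp.trans (hz2.trans_le (min_le_right _ _))

theorem theorem11 (m₁ m₂ : ℕ) (hm : m₂ < m₁) (a b : ℝ) (ha : 0 < a) (hb : 0 < b) :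
    Tendsto (fun p : ℝ => powerHermiteMean p m₁ m₂ a b) atTop (𝓝 (max a b)) ∧
    Tendsto (fun p : ℝ => powerHermiteMean p m₁ m₂ a b) atBot (𝓝 (min a b)) := by
  rcases lt_trichotomy a b with hab | rfl | hab
  · rw [max_eq_right hab.le, min_eq_left hab.le]
    exact tendsto_powerHermiteMean_of_lt hm ha hab
  · simp [powerHermiteMean, hermiteMean]
  · rw [max_eq_left hab.le, min_eq_right hab.le]
    have h := tendsto_powerHermiteMean_of_lt hm hb hab
    have hcomm : ∀ p, powerHermiteMean p m₁ m₂ b a = powerHermiteMean p m₁ m₂ a b :=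
      fun p => hermiteMean_comm _ _ _ _ _
    simpa only [hcomm] using h
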